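/- Let $(R,\mathfrak m)$ be a commutative Noetherian Cohen–Macaulay local ring of Krull dimension $d>0$. For an $R$-module $M$ put $\Gamma_{\mathfrak m}(M)=\{x\in M\mid \mathfrak m^r x=0\text{ for some }r>0\}$, and let $H^i_{\mathfrak m}$ be the $i$-th right derived functor of $\Gamma_{\mathfrak m}$. A finitely generated module $N$ over a Noetherian local ring $A$ is called maximal Cohen–Macaulay (MCM) if $\operatorname{depth}_A N\ge\dim A$; by convention $\operatorname{depth} 0=\infty$, so the zero module is MCM. For a finitely generated $R$-module $M$ consider the following conditions. (a) There is an exact sequence $0\to L\to M\to N\to 0$ of $R$-modules such that $L$ has finite length and $N$ is MCM. (b) The module $M/\Gamma_{\mathfrak m}(M)$ is MCM. (c) $H^i_{\mathfrak m}(M)=0$ for all integers $i\ge 0$ with $i\ne 0,d$. (d) $M$ is locally MCM on the punctured spectrum of $R$, i.e. for every prime ideal $\mathfrak p\ne\mathfrak m$ of $R$ the $R_{\mathfrak p}$-module $M_{\mathfrak p}$ is MCM. Then the following hold. (1) For every finitely generated $R$-module $M$ one has (a) $\Leftrightarrow$ (b) $\Leftrightarrow$ (c) $\Rightarrow$ (d).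 (2) If $d=1$, then (d) $\Rightarrow$ (c) for every finitely generated $R$-module $M$. (3) If $d\ge 2$, then the implication (d) $\Rightarrow$ (c) fails for $R$: the finitely generated $R$-module $M=\mathfrak m$ satisfies (d) but not (c). -/

import Mathlib

open CategoryTheory

universe u v

namespace CMSpherical

section Gamma

variable {R : Type u} [CommRing R]

/-- The `I`-torsion functor `Γ_I` on `R`-modules: `Γ_I(M)` is the submodule of the elements of `M`
that are killed by some power of `I`, and `Γ_I(f)` is the restriction of `f`. -/
noncomputable def gammaFunctor (I : Ideal R) : ModuleCat.{v} R ⥤ ModuleCat.{v} R where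
  obj M := ModuleCat.of R (I.primaryComponent M)
  map f := ModuleCat.ofHom (Ideal.primaryComponent.map I f.hom)
  map_id _ := by ext; rfl
  map_comp _ _ := by ext; rfl

instance (I : Ideal R) : (gammaFunctor.{u, v} I).Additive where
  map_add := by intros; ext; rfl

/-- The local cohomology functor `H^i_I`: the `i`-th right derived functor of `Γ_I`. -/
noncomputable def localCoh (I : Ideal R) (i : ℕ) : ModuleCat.{u} R ⥤ ModuleCat.{u} R :=
  (gammaFunctor.{u, u} I).rightDerived i

/-- The description of `Γ_I(M)` by elements, with positive exponents. -/
theorem mem_gamma_iff (I : Ideal R) {M : Type v} [AddCommGroup M] [Module R M] (x : M) :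
    x ∈ I.primaryComponent M ↔ ∃ r : ℕ, 0 < r ∧ ∀ a ∈ I ^ r, a • x = 0 := by
  rw [Ideal.primaryComponent_mem]
  constructor
  · rintro ⟨n, hn⟩
    refine ⟨n + 1, n.succ_pos, fun a ha => ?_⟩
    exact (Submodule.mem_torsionBySet_iff _ _).1 hn ⟨a, Ideal.pow_le_pow_right n.le_succ ha⟩
  · rintro ⟨r, _, hr⟩
    exact ⟨r, (Submodule.mem_torsionBySet_iff _ _).2 fun a => hr a a.2⟩

end Gamma

section Depth

variable (R : Type u) [CommRing R] [IsLocalRing R]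

/-- The depth of a finitely generated module `M` over a Noetherian local ring `(R, 𝔪)`: the
supremum of the lengths of the `M`-regular sequences in `𝔪`. For `M ≠ 0` the condition `xM ≠ M` on
such a sequence `x` holds automatically by Nakayama's lemma, so weakly regular sequences are the
same as regular ones; for `M = 0` every sequence is weakly regular, which gives the usual
convention `depth 0 = ∞`. -/
noncomputable def depth (M : Type v) [AddCommGroup M] [Module R M] : ℕ∞ :=
  ⨆ rs ∈ {rs : List R | (∀ r ∈ rs, r ∈ IsLocalRing.maximalIdeal R) ∧
    RingTheory.Sequence.IsWeaklyRegular M rs}, (rs.length : ℕ∞)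

/-- A maximal Cohen--Macaulay module over a Noetherian local ring `R`: a finitely generated module
whose depth is at least `dim R`. The zero module is one. -/
def IsMCM (M : Type v) [AddCommGroup M] [Module R M] : Prop :=
  Module.Finite R M ∧ ringKrullDim R ≤ (depth R M : WithBot ℕ∞)

/-- A Cohen--Macaulay local ring: a Noetherian local ring whose depth equals its Krull
dimension. -/
def IsCMLocalRing : Prop :=
  IsNoetherianRing R ∧ (depth R R : WithBot ℕ∞) = ringKrullDim R

/-- `M` is an extension of a maximal Cohen--Macaulay module by a module of finite length: there is
an exact sequence `0 → L → M → N → 0` with `L` of finite length and `N` maximal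
Cohen--Macaulay. -/
def IsExtMCMByFiniteLength (M : Type v) [AddCommGroup M] [Module R M] : Prop :=
  ∃ (L N : Type v) (_ : AddCommGroup L) (_ : Module R L) (_ : AddCommGroup N) (_ : Module R N)
    (f : L →ₗ[R] M) (g : M →ₗ[R] N),
    Function.Injective f ∧ Function.Exact f g ∧ Function.Surjective g ∧
      IsFiniteLength R L ∧ IsMCM R N

/-- `M` is `n`-H-spherical: `M` is finitely generated and `H^i_𝔪(M) = 0` for all
`i ≠ 0, n`. -/
def IsHSpherical (n : ℕ) (M : Type u) [AddCommGroup M] [Module R M] : Prop :=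
  Module.Finite R M ∧ ∀ i : ℕ, i ≠ 0 → i ≠ n →
    Limits.IsZero ((localCoh (IsLocalRing.maximalIdeal R) i).obj (ModuleCat.of R M))

/-- `M` is locally maximal Cohen--Macaulay on the punctured spectrum of `R`: for every prime ideal
`𝔭 ≠ 𝔪` the `R_𝔭`-module `M_𝔭` is maximal Cohen--Macaulay. -/
def IsLocallyMCMOnPuncturedSpectrum (M : Type v) [AddCommGroup M] [Module R M] : Prop :=
  ∀ (p : Ideal R) [p.IsPrime], p ≠ IsLocalRing.maximalIdeal R →
    IsMCM (Localization.AtPrime p) (LocalizedModule.AtPrime p M)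

end Depth

end CMSpherical

namespace CMSpherical

open Abelian

/-! ### Local cohomology as a colimit of Ext groups. -/

section LocalCohomology

variable {R : Type u} [CommRing R]

/-! Write `Γ` for `Γ_𝔪`. Since `H^i_𝔪(M)` is the colimit of `Ext^i(R ⧸ 𝔪 ^ n, M)`, its vanishing can
be chased through the long exact sequences of Ext. Over a Noetherian ring torsion modules have no
cohomology in positive degrees, so passing from `M` to `M ⧸ Γ(M)` kills `H^0` and does not affect
the vanishing of `H^i` for `i > 0`. Depth at least `k` means vanishing below `k`
(`natCast_le_depth_iff_extColimitVanishes`). With Grothendieck vanishing above `d` this gives (b) ⇔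
(c).

As `d > 0`, an MCM module has no `𝔪`-torsion, so the submodule `L` in (a) must be `Γ(M)`; this gives
(a) ⇔ (b). For (d), MCM modules localize, and `M` and `M ⧸ Γ(M)` agree at every `𝔭 ≠ 𝔪`. If `d = 1`,
then (c) is Grothendieck vanishing.

For `d ≥ 2`, `𝔪` and `R` agree off the closed point, so `𝔪` satisfies (d). As `Γ(𝔪) = 0`, condition
(c) would make `𝔪` itself MCM, but its depth is less than 2 (`not_two_le_depth_maximalIdeal`). -/

theorem isZero_localCoh_succ_iff_of_injectiveResolution (I : Ideal R) {M : ModuleCat.{u} R}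
    (P : InjectiveResolution M) (i : ℕ) :
    Limits.IsZero ((localCoh I (i + 1)).obj M) ↔
      ∀ z ∈ I.primaryComponent (P.cocomplex.X (i + 1)), P.cocomplex.d (i + 1) (i + 2) z = 0 →
        ∃ y ∈ I.primaryComponent (P.cocomplex.X i), P.cocomplex.d i (i + 1) y = z := by
  rw [localCoh, (P.isoRightDerivedObj (gammaFunctor I) (i + 1)).isZero_iff]
  change Limits.IsZero (HomologicalComplex.homology _ _) ↔ _
  rw [← HomologicalComplex.exactAt_iff_isZero_homology,
    HomologicalComplex.exactAt_iff' _ i (i + 1) (i + 2) (by simp) (by simp),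
    ShortComplex.moduleCat_exact_iff]
  constructor
  · intro h z hz hd
    obtain ⟨y, hy⟩ := h ⟨z, hz⟩ (Subtype.ext hd)
    exact ⟨y.1, y.2, congrArg Subtype.val hy⟩
  · rintro h ⟨z, hz⟩ hd
    obtain ⟨y, hy, hyz⟩ := h z hz (congrArg Subtype.val hd)
    exact ⟨⟨y, hy⟩, Subtype.ext hyz⟩

theorem mem_primaryComponent_iff (I : Ideal R) {M : Type v} [AddCommGroup M] [Module R M] (x : M) :
    x ∈ I.primaryComponent M ↔ ∃ n : ℕ, ∀ a ∈ I ^ n, a • x = 0 :=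
  ⟨fun h => let ⟨n, _, hn⟩ := (mem_gamma_iff I x).1 h; ⟨n, hn⟩,
    fun ⟨n, hn⟩ => (mem_gamma_iff I x).2
      ⟨n + 1, n.succ_pos, fun a ha => hn a (Ideal.pow_le_pow_right n.le_succ ha)⟩⟩

/-- The map `R ⧸ I → M` determined by an element of `M` that is killed by `I`. -/
noncomputable def quotDesc {I : Ideal R} {M : ModuleCat.{u} R} (x : M) (hx : ∀ a ∈ I, a • x = 0) :
    ModuleCat.of R (R ⧸ I) ⟶ M :=
  ModuleCat.ofHom (Submodule.liftQ _ (LinearMap.toSpanSingleton R _ x) hx)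

theorem quotDesc_one {I : Ideal R} {M : ModuleCat.{u} R} (x : M) (hx : ∀ a ∈ I, a • x = 0) :
    quotDesc x hx (1 : R ⧸ I) = x :=
  one_smul R x

theorem hom_quot_ext {I : Ideal R} {M : ModuleCat.{u} R} {f g : ModuleCat.of R (R ⧸ I) ⟶ M}
    (h : f (1 : R ⧸ I) = g (1 : R ⧸ I)) : f = g := by
  refine ModuleCat.hom_ext (Submodule.linearMap_qext _ (LinearMap.ext_ring ?_))
  exact h

theorem smul_hom_quot_one {I : Ideal R} {M : ModuleCat.{u} R} (f : ModuleCat.of R (R ⧸ I) ⟶ M)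
    {a : R} (ha : a ∈ I) : a • f (1 : R ⧸ I) = 0 := by
  change a • f.hom (1 : R ⧸ I) = 0
  rw [← map_smul, show a • (1 : R ⧸ I) = 0 from ?_, map_zero]
  rw [Algebra.smul_def, mul_one]
  exact Ideal.Quotient.eq_zero_iff_mem.2 ha

/-- The transition map `R ⧸ I ^ n' → R ⧸ I ^ n`. -/
noncomputable def quotPowFactor (I : Ideal R) {n n' : ℕ} (h : n ≤ n') :
    ModuleCat.of R (R ⧸ I ^ n') ⟶ ModuleCat.of R (R ⧸ I ^ n) :=
  ModuleCat.ofHom (Submodule.factor (Ideal.pow_le_pow_right h))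

theorem quotPowFactor_comp (I : Ideal R) {n n' n'' : ℕ} (h : n ≤ n') (h' : n' ≤ n'') :
    quotPowFactor I h' ≫ quotPowFactor I h = quotPowFactor I (h.trans h') :=
  hom_quot_ext rfl

theorem quotPowFactor_comp_apply_one (I : Ideal R) {n n' : ℕ} (h : n ≤ n') {M : ModuleCat.{u} R}
    (f : ModuleCat.of R (R ⧸ I ^ n) ⟶ M) :
    (quotPowFactor I h ≫ f) (1 : R ⧸ I ^ n') = f (1 : R ⧸ I ^ n) :=
  rfl

/-- Every class in `Ext^i(R ⧸ I ^ n, M)` dies in `Ext^i(R ⧸ I ^ n', M)` for some `n' ≥ n`, i.e.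
the colimit of these groups, which is the local cohomology `H^i_I(M)`, vanishes. -/
def ExtColimitVanishes (I : Ideal R) (i : ℕ) (M : ModuleCat.{u} R) : Prop :=
  ∀ (n : ℕ) (ξ : Ext (ModuleCat.of R (R ⧸ I ^ n)) M i), ∃ (n' : ℕ) (h : n ≤ n'),
    (Ext.mk₀ (quotPowFactor I h)).comp ξ (zero_add i) = 0

/-- Elements killed by `I ^ n` are maps out of `R ⧸ I ^ n`. Hence torsion cocycles of an injective
resolution represent Ext classes, and raising `n` lets a torsion cochain bounding such a cocycle
become such a map. -/
theorem isZero_localCoh_succ_iff (I : Ideal R) (i : ℕ) (M : ModuleCat.{u} R) :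
    Limits.IsZero ((localCoh I (i + 1)).obj M) ↔ ExtColimitVanishes I (i + 1) M := by
  have P : InjectiveResolution M := injectiveResolution M
  rw [isZero_localCoh_succ_iff_of_injectiveResolution I P]
  constructor
  · intro h n ξ
    obtain ⟨f, hf, rfl⟩ := P.extMk_surjective ξ (i + 2) rfl
    obtain ⟨y, hy, hyz⟩ := h (f (1 : R ⧸ I ^ n))
      ((mem_primaryComponent_iff _ _).2 ⟨n, fun a ha => smul_hom_quot_one f ha⟩)
      (congrArg (fun g => g.hom (1 : R ⧸ I ^ n)) hf)
    obtain ⟨r, hr⟩ := (mem_primaryComponent_iff _ _).1 hy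
    refine ⟨max n r, le_max_left _ _, ?_⟩
    rw [P.mk₀_comp_extMk, P.extMk_eq_zero_iff _ _ _ _ i rfl]
    refine ⟨quotDesc y fun a ha => hr a (Ideal.pow_le_pow_right (le_max_right _ _) ha),
      hom_quot_ext ?_⟩
    rw [ModuleCat.comp_apply, quotDesc_one, quotPowFactor_comp_apply_one, hyz]
  · intro h z hz hd
    obtain ⟨n, hn⟩ := (mem_primaryComponent_iff _ _).1 hz
    have hf : quotDesc z hn ≫ P.cocomplex.d (i + 1) (i + 2) = 0 := by
      refine hom_quot_ext ?_
      rw [ModuleCat.comp_apply, quotDesc_one, hd]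
      rfl
    obtain ⟨n', hn', h0⟩ := h n (P.extMk (quotDesc z hn) (i + 2) rfl hf)
    rw [P.mk₀_comp_extMk, P.extMk_eq_zero_iff _ _ _ _ i rfl] at h0
    obtain ⟨g, hg⟩ := h0
    refine ⟨g (1 : R ⧸ I ^ n'),
      (mem_primaryComponent_iff _ _).2 ⟨n', fun a ha => smul_hom_quot_one g ha⟩, ?_⟩
    rw [← ModuleCat.comp_apply, hg, quotPowFactor_comp_apply_one, quotDesc_one]

theorem extColimitVanishes_zero_iff (I : Ideal R) (M : ModuleCat.{u} R) :
    ExtColimitVanishes I 0 M ↔ I.primaryComponent M = ⊥ := by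
  rw [eq_bot_iff]
  constructor
  · intro h x hx
    obtain ⟨n, hn⟩ := (mem_primaryComponent_iff _ _).1 hx
    obtain ⟨n', hn', h0⟩ := h n (Ext.mk₀ (quotDesc x hn))
    rw [Ext.mk₀_comp_mk₀, Ext.mk₀_eq_zero_iff] at h0
    have h1 := quotPowFactor_comp_apply_one I hn' (quotDesc x hn)
    rw [h0, quotDesc_one] at h1
    exact h1.symm
  · intro h n ξ
    obtain ⟨f, rfl⟩ := Ext.addEquiv₀.symm.surjective ξ
    refine ⟨n, le_rfl, ?_⟩
    suffices f = 0 by simp [this]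
    refine hom_quot_ext ?_
    exact (Submodule.mem_bot _).1 (h ((mem_primaryComponent_iff _ _).2
      ⟨n, fun a ha => smul_hom_quot_one f ha⟩))

/-- Exactness of the colimit sequence, as in the next two lemmas: raise `n` once so that the class
lifts along the Ext sequence, and again to kill the lift. -/
theorem extColimitVanishes_middle {I : Ideal R} {i : ℕ} {S : ShortComplex (ModuleCat.{u} R)}
    (hS : S.ShortExact) (h₁ : ExtColimitVanishes I i S.X₁) (h₃ : ExtColimitVanishes I i S.X₃) :
    ExtColimitVanishes I i S.X₂ := by
  intro n ξ
  obtain ⟨n', hn', h0⟩ := h₃ n (ξ.comp (Ext.mk₀ S.g) (add_zero i))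
  rw [← Ext.comp_assoc _ _ _ (zero_add i) (add_zero i) (by simp)] at h0
  obtain ⟨η, hη⟩ := Ext.covariant_sequence_exact₂ _ hS _ h0
  obtain ⟨n'', hn'', h1⟩ := h₁ n' η
  refine ⟨n'', hn'.trans hn'', ?_⟩
  rw [← quotPowFactor_comp I hn' hn'', ← Ext.mk₀_comp_mk₀,
    Ext.comp_assoc _ _ _ (zero_add 0) (zero_add i) (by simp), ← hη,
    ← Ext.comp_assoc _ _ _ (zero_add i) (add_zero i) (by simp), h1, Ext.zero_comp]

theorem extColimitVanishes_right {I : Ideal R} {i : ℕ} {S : ShortComplex (ModuleCat.{u} R)}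
    (hS : S.ShortExact) (h₂ : ExtColimitVanishes I i S.X₂)
    (h₁ : ExtColimitVanishes I (i + 1) S.X₁) : ExtColimitVanishes I i S.X₃ := by
  intro n ξ
  obtain ⟨n', hn', h0⟩ := h₁ n (ξ.comp hS.extClass rfl)
  rw [← Ext.comp_assoc _ _ _ (zero_add i) rfl (by simp)] at h0
  obtain ⟨η, hη⟩ := Ext.covariant_sequence_exact₃ _ hS _ rfl h0
  obtain ⟨n'', hn'', h1⟩ := h₂ n' η
  refine ⟨n'', hn'.trans hn'', ?_⟩
  rw [← quotPowFactor_comp I hn' hn'', ← Ext.mk₀_comp_mk₀,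
    Ext.comp_assoc _ _ _ (zero_add 0) (zero_add i) (by simp), ← hη,
    ← Ext.comp_assoc _ _ _ (zero_add i) (add_zero i) (by simp), h1, Ext.zero_comp]

theorem extColimitVanishes_left {I : Ideal R} {i : ℕ} {S : ShortComplex (ModuleCat.{u} R)}
    (hS : S.ShortExact) (h₃ : ExtColimitVanishes I i S.X₃)
    (h₂ : ExtColimitVanishes I (i + 1) S.X₂) : ExtColimitVanishes I (i + 1) S.X₁ := by
  intro n ξ
  obtain ⟨n', hn', h0⟩ := h₂ n (ξ.comp (Ext.mk₀ S.f) (add_zero _))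
  rw [← Ext.comp_assoc _ _ _ (zero_add _) (add_zero _) (by simp)] at h0
  obtain ⟨η, hη⟩ := Ext.covariant_sequence_exact₁ _ hS _ h0 rfl
  obtain ⟨n'', hn'', h1⟩ := h₃ n' η
  refine ⟨n'', hn'.trans hn'', ?_⟩
  rw [← quotPowFactor_comp I hn' hn'', ← Ext.mk₀_comp_mk₀,
    Ext.comp_assoc _ _ _ (zero_add 0) (zero_add _) (by simp), ← hη,
    ← Ext.comp_assoc _ _ _ (zero_add i) rfl (by simp), h1, Ext.zero_comp]

end LocalCohomology

/-! ### Torsion modules and their cohomology. -/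

section Torsion

variable {R : Type u} [CommRing R]

theorem exists_linearMap_comp_eq_of_ker_le {Q X Y : Type u} [AddCommGroup Q] [Module R Q]
    [Module.Injective R Q] [AddCommGroup X] [Module R X] [AddCommGroup Y] [Module R Y]
    (f : X →ₗ[R] Y) (g : X →ₗ[R] Q) (h : f.ker ≤ g.ker) : ∃ k : Y →ₗ[R] Q, ∀ x, k (f x) = g x := by
  obtain ⟨k, hk⟩ := Module.Injective.out (f.ker.liftQ f le_rfl)
    (LinearMap.ker_eq_bot.1 (Submodule.ker_liftQ_eq_bot _ _ _ le_rfl)) (f.ker.liftQ g h)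
  exact ⟨k, fun x => hk (Submodule.Quotient.mk x)⟩

theorem exists_pow_smul_eq_zero_of_le_primaryComponent (I : Ideal R) {M : Type v} [AddCommGroup M]
    [Module R M] {N : Submodule R M} (hN : N.FG) (h : N ≤ I.primaryComponent M) :
    ∃ n : ℕ, ∀ a ∈ I ^ n, ∀ x ∈ N, a • x = 0 := by
  induction N, hN using Submodule.fg_induction with
  | singleton x =>
    obtain ⟨n, hn⟩ := (mem_primaryComponent_iff I x).1 (h (Submodule.mem_span_singleton_self x))
    refine ⟨n, fun a ha y hy => ?_⟩
    obtain ⟨b, rfl⟩ := Submodule.mem_span_singleton.1 hy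
    rw [smul_comm, hn a ha, smul_zero]
  | sup N₁ N₂ _ _ h₁ h₂ =>
    obtain ⟨n₁, hn₁⟩ := h₁ (le_sup_left.trans h)
    obtain ⟨n₂, hn₂⟩ := h₂ (le_sup_right.trans h)
    refine ⟨max n₁ n₂, fun a ha x hx => ?_⟩
    obtain ⟨y, hy, z, hz, rfl⟩ := Submodule.mem_sup.1 hx
    rw [smul_add, hn₁ a (Ideal.pow_le_pow_right (le_max_left _ _) ha) y hy,
      hn₂ a (Ideal.pow_le_pow_right (le_max_right _ _) ha) z hz, add_zero]

/-- Baer's criterion and Artin–Rees: `I ^ c` kills the image of `g`, and `J ⊓ I ^ (k + c) ≤ I ^ c •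
J`, so `g` factors through the image of `J` in `R ⧸ I ^ (k + c)`. An extension of it to that
quotient has torsion values. -/
theorem injective_primaryComponent [IsNoetherianRing R] (I : Ideal R) (Q : Type u) [AddCommGroup Q]
    [Module R Q] [Module.Injective R Q] : Module.Injective R (I.primaryComponent Q) := by
  refine Module.Baer.injective fun J g => ?_
  obtain ⟨c, hc⟩ := exists_pow_smul_eq_zero_of_le_primaryComponent I
    (N := LinearMap.range ((I.primaryComponent Q).subtype ∘ₗ g))
    ((LinearMap.range_eq_map (_ : J →ₗ[R] Q)) ▸ Submodule.FG.map _ (IsNoetherian.noetherian _))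
    (by rintro _ ⟨x, rfl⟩; exact (g x).2)
  obtain ⟨k, hk⟩ := I.exists_pow_inf_eq_pow_smul (M := R) J
  have hvan : ∀ x ∈ J ⊓ I ^ (k + c), ∀ hx : x ∈ J, (g ⟨x, hx⟩ : Q) = 0 := by
    intro x hx hxJ
    have h1 : x ∈ I ^ c • (J : Submodule R R) := by
      have h2 := hk (k + c) le_self_add
      rw [Nat.add_sub_cancel_left] at h2
      have h3 : x ∈ I ^ c • (I ^ k • (⊤ : Submodule R R) ⊓ J) := by
        rw [← h2]
        exact ⟨by simpa using hx.2, hxJ⟩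
      exact Submodule.smul_mono le_rfl inf_le_right h3
    revert hxJ
    refine Submodule.smul_induction_on' h1 ?_ ?_
    · intro a ha y hy hay
      have := hc a ha _ ⟨⟨y, hy⟩, rfl⟩
      rw [← map_smul] at this
      exact this
    · intro y hy z hz h1 h2 hyz
      have hy' := h1 (Submodule.smul_le_right hy)
      have hz' := h2 (Submodule.smul_le_right hz)
      have : g ⟨y + z, hyz⟩ = g ⟨y, Submodule.smul_le_right hy⟩ +
          g ⟨z, Submodule.smul_le_right hz⟩ :=
        map_add g ⟨y, _⟩ ⟨z, _⟩
      rw [this, Submodule.coe_add, hy', hz', add_zero]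
  obtain ⟨h, hh⟩ := exists_linearMap_comp_eq_of_ker_le
    ((I ^ (k + c)).mkQ ∘ₗ J.subtype) ((I.primaryComponent Q).subtype ∘ₗ g) (by
      rintro ⟨x, hxJ⟩ hx
      exact hvan x ⟨hxJ, (Submodule.Quotient.mk_eq_zero _).1 hx⟩ hxJ)
  let h' := h ∘ₗ (I ^ (k + c)).mkQ
  have h'mem : ∀ x, h' x ∈ I.primaryComponent Q := by
    refine fun x => (mem_primaryComponent_iff _ _).2 ⟨k + c, fun a ha => ?_⟩
    rw [← map_smul]
    change h (Submodule.Quotient.mk (a * x)) = 0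
    rw [(Submodule.Quotient.mk_eq_zero _).2 ((I ^ (k + c)).mul_mem_right x ha), map_zero]
  exact ⟨h'.codRestrict _ h'mem, fun x hx => Subtype.ext (hh ⟨x, hx⟩)⟩

theorem extColimitVanishes_succ_of_injective (I : Ideal R) (i : ℕ) (Q : ModuleCat.{u} R)
    [Injective Q] : ExtColimitVanishes I (i + 1) Q :=
  fun n ξ => ⟨n, le_rfl, by rw [Ext.eq_zero_of_injective ξ, Ext.comp_zero]⟩

theorem shortExact_of_linearMap {A B C : Type u} [AddCommGroup A] [Module R A] [AddCommGroup B]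
    [Module R B] [AddCommGroup C] [Module R C] {f : A →ₗ[R] B} {g : B →ₗ[R] C}
    (hf : Function.Injective f) (hfg : Function.Exact f g) (hg : Function.Surjective g) :
    (ShortComplex.mk (ModuleCat.ofHom f) (ModuleCat.ofHom g)
      (ModuleCat.hom_ext hfg.linearMap_comp_eq_zero)).ShortExact :=
  ShortComplex.ShortExact.mk' ((ShortComplex.ShortExact.moduleCat_exact_iff_function_exact _).2 hfg)
    ((ModuleCat.mono_iff_injective _).2 hf) ((ModuleCat.epi_iff_surjective _).2 hg)

theorem exists_torsion_injective_embedding [IsNoetherianRing R] (I : Ideal R) (T : Type u)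
    [AddCommGroup T] [Module R T] (hT : I.primaryComponent T = ⊤) :
    ∃ (E : Type u) (_ : AddCommGroup E) (_ : Module R E) (j : T →ₗ[R] E),
      Module.Injective R E ∧ Function.Injective j ∧ I.primaryComponent E = ⊤ := by
  let ι := Injective.ι (ModuleCat.of R T)
  let Q := Injective.under (ModuleCat.of R T)
  have : Module.Injective R Q :=
    Module.injective_module_of_injective_object R Q (inj := (inferInstance : Injective Q))
  refine ⟨I.primaryComponent Q, inferInstance, inferInstance,
    ι.hom.codRestrict _ fun x => Ideal.primaryComponent_map_mem I ι.hom ⟨x, hT ▸ trivial⟩,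
    injective_primaryComponent I Q, ?_, ?_⟩
  · intro x y h
    exact (ModuleCat.mono_iff_injective ι).1 inferInstance (congrArg Subtype.val h)
  · refine eq_top_iff.2 fun x _ => (mem_primaryComponent_iff _ _).2 ?_
    obtain ⟨n, hn⟩ := (mem_primaryComponent_iff _ _).1 x.2
    exact ⟨n, fun a ha => Subtype.ext (hn a ha)⟩

/-- Dimension shifting along `0 → T → E → E ⧸ T → 0`, with `E` injective and torsion, so that `E ⧸
T` is torsion too. -/
theorem extColimitVanishes_succ_of_primaryComponent_eq_top [IsNoetherianRing R] (I : Ideal R)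
    (i : ℕ) (T : Type u) [AddCommGroup T] [Module R T] (hT : I.primaryComponent T = ⊤) :
    ExtColimitVanishes I (i + 1) (ModuleCat.of R T) := by
  induction i generalizing T with
  | zero =>
    obtain ⟨E, _, _, j, _, hj, hE⟩ := exists_torsion_injective_embedding I T hT
    have hS := shortExact_of_linearMap hj (LinearMap.exact_map_mkQ_range j)
      (Submodule.mkQ_surjective _)
    have := Module.injective_object_of_injective_module R E
    intro n ξ
    obtain ⟨η, rfl⟩ := Ext.covariant_sequence_exact₁ _ hS ξ (Ext.eq_zero_of_injective _) rfl
    obtain ⟨f, rfl⟩ := Ext.addEquiv₀.symm.surjective η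
    -- The class is the connecting image of `f`. A lift `e` of `f 1` is torsion, so `f` lifts to `E`
    -- once `n` is raised, and the class dies.
    obtain ⟨e, he⟩ := Submodule.mkQ_surjective _ (f (1 : R ⧸ I ^ n))
    obtain ⟨r, hr⟩ := (mem_primaryComponent_iff I e).1 (hE ▸ trivial)
    refine ⟨max n r, le_max_left _ _, ?_⟩
    have hf : quotPowFactor I (le_max_left n r) ≫ f =
        quotDesc (M := ModuleCat.of R E) e
          (fun a ha => hr a (Ideal.pow_le_pow_right (le_max_right _ _) ha)) ≫
          ModuleCat.ofHom j.range.mkQ := by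
      refine hom_quot_ext ?_
      rw [quotPowFactor_comp_apply_one, ModuleCat.comp_apply, quotDesc_one, ← he]
      rfl
    rw [← Ext.comp_assoc _ _ _ (zero_add 0) (zero_add 1) (by simp), Ext.addEquiv₀_symm_apply,
      Ext.mk₀_comp_mk₀, hf, ← Ext.mk₀_comp_mk₀,
      Ext.comp_assoc _ _ _ (zero_add 0) (zero_add 1) (by simp), hS.comp_extClass, Ext.comp_zero]
  | succ i ih =>
    obtain ⟨E, _, _, j, _, hj, hE⟩ := exists_torsion_injective_embedding I T hT
    have hS := shortExact_of_linearMap hj (LinearMap.exact_map_mkQ_range j)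
      (Submodule.mkQ_surjective _)
    have := Module.injective_object_of_injective_module R E
    refine extColimitVanishes_left hS (ih _ ?_) (extColimitVanishes_succ_of_injective I _ _)
    refine eq_top_iff.2 fun x _ => ?_
    obtain ⟨e, rfl⟩ := Submodule.mkQ_surjective _ x
    exact Ideal.primaryComponent_map_mem I j.range.mkQ ⟨e, hE ▸ trivial⟩

theorem primaryComponent_primaryComponent (I : Ideal R) (M : Type v) [AddCommGroup M]
    [Module R M] : I.primaryComponent (I.primaryComponent M) = ⊤ := by
  refine eq_top_iff.2 fun x _ => (mem_primaryComponent_iff _ _).2 ?_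
  obtain ⟨n, hn⟩ := (mem_primaryComponent_iff _ _).1 x.2
  exact ⟨n, fun a ha => Subtype.ext (hn a ha)⟩

theorem extColimitVanishes_succ_quotient_primaryComponent_iff [IsNoetherianRing R] (I : Ideal R)
    (i : ℕ) (M : Type u) [AddCommGroup M] [Module R M] :
    ExtColimitVanishes I (i + 1) (ModuleCat.of R (M ⧸ I.primaryComponent M)) ↔
      ExtColimitVanishes I (i + 1) (ModuleCat.of R M) := by
  have hS := shortExact_of_linearMap (I.primaryComponent M).subtype_injective
    (LinearMap.exact_subtype_mkQ _) (Submodule.mkQ_surjective _)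
  have hT := fun j => extColimitVanishes_succ_of_primaryComponent_eq_top I j _
    (primaryComponent_primaryComponent I M)
  exact ⟨fun h => extColimitVanishes_middle hS (hT _) h,
    fun h => extColimitVanishes_right hS h (hT _)⟩

theorem primaryComponent_quotient_primaryComponent [IsNoetherianRing R] (I : Ideal R) (M : Type v)
    [AddCommGroup M] [Module R M] :
    I.primaryComponent (M ⧸ I.primaryComponent M) = ⊥ := by
  refine eq_bot_iff.2 fun z hz => ?_
  obtain ⟨z, rfl⟩ := Submodule.mkQ_surjective _ z
  obtain ⟨n, hn⟩ := (mem_primaryComponent_iff _ _).1 hz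
  refine (Submodule.Quotient.mk_eq_zero _).2 ((mem_primaryComponent_iff _ _).2 ?_)
  obtain ⟨m, hm⟩ := exists_pow_smul_eq_zero_of_le_primaryComponent I
    (N := Submodule.map (LinearMap.toSpanSingleton R M z) (I ^ n))
    ((IsNoetherian.noetherian _).map _) (by
      rintro _ ⟨a, ha, rfl⟩
      exact (Submodule.Quotient.mk_eq_zero _).1 (hn a ha))
  refine ⟨m + n, fun a ha => ?_⟩
  rw [pow_add] at ha
  refine Submodule.mul_induction_on ha (fun b hb c hc => ?_) fun b c hb hc => ?_
  · rw [mul_smul]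
    exact hm b hb _ ⟨c, hc, rfl⟩
  · rw [add_smul, hb, hc, add_zero]

end Torsion

/-! ### Vanishing above the dimension. -/

section GrothendieckVanishing

variable {R : Type u} [CommRing R]

/-- This says that `Γ_J(Q)` surjects onto its localization at `x`: the fraction `w / x ^ n` is the
image of `w'`. -/
theorem exists_pow_smul_sub_eq_zero_of_injective [IsNoetherianRing R] (J : Ideal R) {Q : Type u}
    [AddCommGroup Q] [Module R Q] [Module.Injective R Q] (x : R) (n : ℕ) {w : Q}
    (hw : w ∈ J.primaryComponent Q) :
    ∃ w' ∈ J.primaryComponent Q, ∃ m : ℕ, x ^ m • (x ^ n • w' - w) = 0 := by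
  obtain ⟨r, hr⟩ := (mem_primaryComponent_iff _ _).1 hw
  let φ : R →ₗ[R] R ⧸ J ^ r := (J ^ r).mkQ
  -- The annihilators of `x ^ k` in `R ⧸ J ^ r` stabilize at `k = m`. Hence `x ^ (n + m) * a ↦ (a *
  -- x ^ m) • w` is well defined on multiples of `x ^ (n + m)` in this quotient; `w'` is the image
  -- of 1 under an extension.
  obtain ⟨m, hm⟩ := monotone_stabilizes_iff_noetherian.2 ‹IsNoetherian R R›
    ⟨fun k => LinearMap.ker (x ^ k • φ), monotone_nat_of_le_succ fun k a ha => by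
      have : (x ^ k • φ) a = 0 := ha
      change (x ^ (k + 1) • φ) a = 0
      rw [pow_succ', mul_smul, LinearMap.smul_apply, this, smul_zero]⟩
  obtain ⟨h, hh⟩ := exists_linearMap_comp_eq_of_ker_le (x ^ (n + m) • φ)
    (LinearMap.toSpanSingleton R Q (x ^ m • w)) (by
      intro a ha
      have h1 : a ∈ LinearMap.ker (x ^ m • φ) := 
        (hm (n + m) (Nat.le_add_left _ _)).symm.le ha
      have h2 : φ (x ^ m * a) = 0 := by
        rw [← smul_eq_mul, map_smul]
        exact h1
      rw [LinearMap.mem_ker, LinearMap.toSpanSingleton_apply, smul_smul, mul_comm]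
      exact hr _ ((Submodule.Quotient.mk_eq_zero _).1 h2))
  refine ⟨h (φ 1), (mem_primaryComponent_iff _ _).2 ⟨r, fun a ha => ?_⟩, m, ?_⟩
  · rw [← map_smul, ← map_smul, smul_eq_mul, mul_one]
    change h (Submodule.Quotient.mk a) = 0
    rw [(Submodule.Quotient.mk_eq_zero _).2 ha, map_zero]
  · have h1 := hh 1
    rw [LinearMap.toSpanSingleton_apply, one_smul, LinearMap.smul_apply, map_smul] at h1
    rw [smul_sub, smul_smul, ← pow_add, add_comm m n, h1, sub_self]

theorem mem_primaryComponent_sup_span_singleton_iff (J : Ideal R) (x : R) {M : Type v}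
    [AddCommGroup M] [Module R M] (z : M) :
    z ∈ (Ideal.span {x} ⊔ J).primaryComponent M ↔
      z ∈ J.primaryComponent M ∧ ∃ n : ℕ, x ^ n • z = 0 := by
  simp only [mem_primaryComponent_iff]
  constructor
  · rintro ⟨n, hn⟩
    exact ⟨⟨n, fun a ha => hn a (Ideal.pow_right_mono le_sup_right n ha)⟩, n,
      hn _ (Ideal.pow_mem_pow (Ideal.mem_sup_left (Ideal.mem_span_singleton_self x)) n)⟩
  · rintro ⟨⟨n, hn⟩, m, hm⟩
    refine ⟨m + n, fun a ha => ?_⟩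
    obtain ⟨b, hb, c, hc, rfl⟩ := Submodule.mem_sup.1 (Ideal.sup_pow_add_le_pow_sup_pow ha)
    rw [Ideal.span_singleton_pow] at hb
    obtain ⟨b, rfl⟩ := Ideal.mem_span_singleton'.1 hb
    rw [add_smul, hn c hc, mul_smul, hm, smul_zero, add_zero]

/-- Each new generator costs one degree. With `z = d y` for the smaller ideal and `x ^ n • z = 0`,
also `x ^ n • y = d w`; dividing `w` by `x ^ n` up to `x`-torsion corrects `y` to an element that is
`x`-torsion as well. -/
theorem exists_d_eq_of_mem_primaryComponent_span [IsNoetherianRing R] {M : ModuleCat.{u} R}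
    (P : InjectiveResolution M) (s : Finset R) (i : ℕ) (hi : s.card ≤ i)
    (z : P.cocomplex.X (i + 1)) (hz : z ∈ (Ideal.span (s : Set R)).primaryComponent _)
    (hd : P.cocomplex.d (i + 1) (i + 2) z = 0) :
    ∃ y ∈ (Ideal.span (s : Set R)).primaryComponent (P.cocomplex.X i),
      P.cocomplex.d i (i + 1) y = z := by
  classical
  induction s using Finset.induction_on generalizing i with
  | empty =>
    obtain ⟨y, hy⟩ := (ShortComplex.moduleCat_exact_iff _).1 (P.exact_succ i) z hd
    refine ⟨y, (mem_primaryComponent_iff _ _).2 ⟨1, fun a ha => ?_⟩, hy⟩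
    simp only [Finset.coe_empty, Ideal.span_empty, pow_one, Ideal.mem_bot] at ha
    rw [ha, zero_smul]
  | insert x s hx ih =>
    rw [Finset.card_insert_of_notMem hx] at hi
    obtain ⟨i, rfl⟩ := Nat.exists_eq_add_of_le' (le_of_add_le_right hi)
    rw [Finset.coe_insert, Ideal.span_insert] at hz ⊢
    obtain ⟨hzs, n, hn⟩ := (mem_primaryComponent_sup_span_singleton_iff _ _ _).1 hz
    obtain ⟨y, hy, rfl⟩ := ih (i + 1) (by omega) z hzs hd
    obtain ⟨w, hw, hwy⟩ := ih i (by omega) (x ^ n • y) (Submodule.smul_mem _ _ hy)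
      (by rw [map_smul, hn])
    have : Module.Injective R (P.cocomplex.X i) :=
      Module.injective_module_of_injective_object R (P.cocomplex.X i) (inj := P.injective i)
    obtain ⟨w', hw', m, hm⟩ := exists_pow_smul_sub_eq_zero_of_injective _ x n hw
    refine ⟨y - P.cocomplex.d i (i + 1) w',
      (mem_primaryComponent_sup_span_singleton_iff _ _ _).2 ⟨Submodule.sub_mem _ hy
        (Ideal.primaryComponent_map_mem _ (P.cocomplex.d i (i + 1)).hom ⟨w', hw'⟩), m + n, ?_⟩, ?_⟩
    · rw [pow_add, mul_smul, smul_sub (x ^ n), ← hwy, ← map_smul, ← map_sub, ← map_smul,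
        ← neg_sub, smul_neg, hm, neg_zero, map_zero]
    · rw [map_sub, sub_eq_self, ← ModuleCat.comp_apply, P.cocomplex.d_comp_d]
      rfl

theorem primaryComponent_eq_of_le_of_pow_le {I J : Ideal R} (h : J ≤ I) {n : ℕ} (hn : I ^ n ≤ J)
    (M : Type v) [AddCommGroup M] [Module R M] : I.primaryComponent M = J.primaryComponent M := by
  ext x
  simp only [mem_primaryComponent_iff]
  exact ⟨fun ⟨k, hk⟩ => ⟨k, fun a ha => hk a (Ideal.pow_right_mono h k ha)⟩,
    fun ⟨k, hk⟩ => ⟨n * k, fun a ha => hk a (Ideal.pow_right_mono hn k (pow_mul I n k ▸ ha))⟩⟩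

/-- Grothendieck's vanishing theorem. -/
theorem isZero_localCoh_of_ringKrullDim_lt [IsNoetherianRing R] [IsLocalRing R] (i : ℕ)
    (hi : ringKrullDim R < i) (M : ModuleCat.{u} R) :
    Limits.IsZero ((localCoh (IsLocalRing.maximalIdeal R) i).obj M) := by
  -- A system of parameters: the ideal it spans has the same torsion as `𝔪`.
  obtain ⟨s, hs, hcard⟩ := Ideal.exists_finset_card_eq_height_of_isNoetherianRing
    (IsLocalRing.maximalIdeal R)
  have hsi : s.card < i := by
    rw [← IsLocalRing.maximalIdeal_height_eq_ringKrullDim, ← hcard] at hi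
    exact_mod_cast hi
  have hrad : IsLocalRing.maximalIdeal R ≤ (Ideal.span (s : Set R)).radical := by
    rw [Ideal.radical_eq_sInf]
    refine le_sInf fun p hp => ?_
    exact hs.2 ⟨hp.2, hp.1⟩ (IsLocalRing.le_maximalIdeal hp.2.ne_top)
  obtain ⟨n, hn⟩ := Ideal.exists_pow_le_of_le_radical_of_fg hrad (IsNoetherian.noetherian _)
  obtain ⟨i, rfl⟩ := Nat.exists_eq_add_of_le' (Nat.one_le_of_lt hsi)
  have P : InjectiveResolution M := injectiveResolution M
  rw [isZero_localCoh_succ_iff_of_injectiveResolution _ P]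
  simp only [primaryComponent_eq_of_le_of_pow_le hs.1.2 hn]
  exact fun z hz hd => exists_d_eq_of_mem_primaryComponent_span P s i (by omega) z hz hd

end GrothendieckVanishing

/-! ### Depth and local cohomology. -/

section Depth

open RingTheory.Sequence IsLocalRing

variable {R : Type u} [CommRing R] [IsLocalRing R]

theorem natCast_le_depth_iff (k : ℕ) (M : Type v) [AddCommGroup M] [Module R M] :
    (k : ℕ∞) ≤ depth R M ↔
      ∃ rs : List R, rs.length = k ∧ (∀ r ∈ rs, r ∈ maximalIdeal R) ∧ IsWeaklyRegular M rs := by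
  constructor
  · intro h
    by_contra! hlt
    have hlen : ∀ rs : List R, (∀ r ∈ rs, r ∈ maximalIdeal R) → IsWeaklyRegular M rs →
        rs.length < k := by
      intro rs hrs hreg
      by_contra! hk
      refine hlt (rs.take k) (by simpa using hk) (fun r hr => hrs r (List.mem_of_mem_take hr)) ?_
      rw [← List.take_append_drop k rs, isWeaklyRegular_append_iff] at hreg
      exact hreg.1
    have h0 : 0 < k := hlen [] (by simp) (IsWeaklyRegular.nil R M)
    have hle : depth R M ≤ ((k - 1 : ℕ) : ℕ∞) := by
      refine iSup₂_le fun rs hrs => ?_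
      have := hlen rs hrs.1 hrs.2
      exact_mod_cast (by omega : rs.length ≤ k - 1)
    have : k ≤ k - 1 := by exact_mod_cast h.trans hle
    omega
  · rintro ⟨rs, rfl, hrs⟩
    exact le_iSup₂ (f := fun (rs : List R) (_ : rs ∈ {rs : List R |
      (∀ r ∈ rs, r ∈ maximalIdeal R) ∧ IsWeaklyRegular M rs}) => (rs.length : ℕ∞)) rs hrs

theorem isMCM_iff_of_ringKrullDim_eq {d : ℕ} (hd : ringKrullDim R = d) (M : Type v)
    [AddCommGroup M] [Module R M] : IsMCM R M ↔ Module.Finite R M ∧ (d : ℕ∞) ≤ depth R M := by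
  rw [IsMCM, hd]
  exact and_congr_right fun _ => WithBot.coe_le_coe

theorem depth_congr {M N : Type*} [AddCommGroup M] [Module R M] [AddCommGroup N] [Module R N]
    (e : M ≃ₗ[R] N) : depth R M = depth R N := by
  simp only [depth, e.isWeaklyRegular_congr]

theorem IsMCM.of_linearEquiv {M N : Type*} [AddCommGroup M] [Module R M] [AddCommGroup N]
    [Module R N] (e : M ≃ₗ[R] N) (h : IsMCM R M) : IsMCM R N := by
  have := h.1
  exact ⟨Module.Finite.equiv e, depth_congr e ▸ h.2⟩

theorem support_quotient_maximalIdeal_pow_subset (n : ℕ) :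
    Module.support R (R ⧸ maximalIdeal R ^ n) ⊆ PrimeSpectrum.zeroLocus (maximalIdeal R) := by
  rw [Module.support_eq_zeroLocus, Ideal.annihilator_quotient]
  exact fun p hp => Ideal.IsPrime.le_of_pow_le hp

/-- A regular sequence already kills each `Ext^i(R ⧸ 𝔪 ^ n, M)` with `i < k`. Conversely `Γ(M) = 0`
gives `Hom(R ⧸ 𝔪, M) = 0`, hence an `M`-regular `x ∈ 𝔪`, and the long exact sequence passes the
vanishing, one degree lower, to `M ⧸ xM`. -/
theorem natCast_le_depth_iff_extColimitVanishes [IsNoetherianRing R] (k : ℕ) (M : Type u)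
    [AddCommGroup M] [Module R M] [Module.Finite R M] :
    (k : ℕ∞) ≤ depth R M ↔
      ∀ i < k, ExtColimitVanishes (maximalIdeal R) i (ModuleCat.of R M) := by
  constructor
  · intro h i hi n ξ
    obtain ⟨rs, rfl, hrs, hreg⟩ := (natCast_le_depth_iff k M).1 h
    suffices ξ = 0 from ⟨n, le_rfl, by rw [this, Ext.comp_zero]⟩
    cases subsingleton_or_nontrivial M
    · rw [← ξ.comp_mk₀_id, show 𝟙 (ModuleCat.of R M) = 0 from ModuleCat.hom_ext
        (LinearMap.ext fun _ => Subsingleton.elim _ _), Ext.mk₀_zero, Ext.comp_zero]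
    · have hlt : maximalIdeal R • (⊤ : Submodule R M) < ⊤ :=
        (Submodule.top_ne_ideal_smul_of_le_jacobson_annihilator
          (maximalIdeal_le_jacobson _)).symm.lt_top
      have := ModuleCat.subsingleton_ext_of_exists_isRegular (maximalIdeal R)
        (ModuleCat.of R (R ⧸ maximalIdeal R ^ n)) (support_quotient_maximalIdeal_pow_subset n)
        (ModuleCat.of R M) hlt rs hrs
        (IsRegular.of_isWeaklyRegular_of_mem_maximalIdeal M hrs hreg) i hi
      exact Subsingleton.elim _ _
  · intro h
    induction k generalizing M with
    | zero => exact zero_le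
    | succ k ih =>
      have h0 := (extColimitVanishes_zero_iff _ _).1 (h 0 k.succ_pos)
      have hsub : Subsingleton ((R ⧸ maximalIdeal R) →ₗ[R] M) := by
        refine subsingleton_of_forall_eq 0 fun f => ?_
        refine Submodule.linearMap_qext _ (LinearMap.ext_ring ?_)
        refine (Submodule.mem_bot R).1 (h0 ▸ (mem_primaryComponent_iff _ _).2 ⟨1, fun a ha => ?_⟩)
        rw [pow_one] at ha
        exact smul_hom_quot_one (M := ModuleCat.of R M) (ModuleCat.ofHom f) ha
      obtain ⟨x, hx, hreg⟩ := IsSMulRegular.subsingleton_linearMap_iff.1 hsub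
      rw [Ideal.annihilator_quotient] at hx
      have hS := IsSMulRegular.smulShortComplex_shortExact (M := ModuleCat.of R M) hreg
      obtain ⟨rs, rfl, hrs, hrs'⟩ := (natCast_le_depth_iff k _).1
        (ih (QuotSMulTop x M) fun i hi => extColimitVanishes_right hS
          (h i (by omega)) (h (i + 1) (by omega)))
      exact (natCast_le_depth_iff _ _).2 ⟨x :: rs, rfl, by simpa using ⟨hx, hrs⟩, hrs'.cons hreg⟩

/-- The cohomological criterion makes the choice of the regular element `x` immaterial. -/
theorem natCast_le_depth_quotSMulTop [IsNoetherianRing R] {k : ℕ} {M : Type u}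
    [AddCommGroup M] [Module R M] [Module.Finite R M] (h : ((k + 1 : ℕ) : ℕ∞) ≤ depth R M) {x : R}
    (hx : IsSMulRegular M x) : (k : ℕ∞) ≤ depth R (QuotSMulTop x M) := by
  rw [natCast_le_depth_iff_extColimitVanishes] at h ⊢
  have hS := IsSMulRegular.smulShortComplex_shortExact (M := ModuleCat.of R M) hx
  exact fun i hi => extColimitVanishes_right hS (h i (by omega)) (h (i + 1) (by omega))

theorem primaryComponent_eq_bot_of_one_le_depth {M : Type v} [AddCommGroup M] [Module R M]
    (h : 1 ≤ depth R M) : (maximalIdeal R).primaryComponent M = ⊥ := by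
  obtain ⟨rs, hlen, hrs, hreg⟩ := (natCast_le_depth_iff 1 M).1 h
  obtain ⟨x, rfl⟩ := List.length_eq_one_iff.1 hlen
  rw [isWeaklyRegular_singleton_iff] at hreg
  refine eq_bot_iff.2 fun z hz => ?_
  obtain ⟨n, hn⟩ := (mem_primaryComponent_iff _ _).1 hz
  refine (hreg.pow n).right_eq_zero_of_smul (hn _ (Ideal.pow_mem_pow (hrs x (by simp)) n))

theorem isMCM_quotient_primaryComponent_iff_isHSpherical [IsNoetherianRing R] {d : ℕ}
    (hdim : ringKrullDim R = d) (M : Type u) [AddCommGroup M] [Module R M]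
    [Module.Finite R M] :
    IsMCM R (M ⧸ (maximalIdeal R).primaryComponent M) ↔ IsHSpherical R d M := by
  rw [isMCM_iff_of_ringKrullDim_eq hdim, natCast_le_depth_iff_extColimitVanishes, IsHSpherical]
  refine and_congr (iff_of_true inferInstance ‹_›) ⟨fun h i hi0 hid => ?_, fun h i hi => ?_⟩
  · rcases lt_or_gt_of_ne hid with hlt | hgt
    · obtain ⟨i, rfl⟩ := Nat.exists_eq_succ_of_ne_zero hi0
      rw [Nat.succ_eq_add_one, isZero_localCoh_succ_iff,
        ← extColimitVanishes_succ_quotient_primaryComponent_iff]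
      exact h _ hlt
    · exact isZero_localCoh_of_ringKrullDim_lt i (by rw [hdim]; exact_mod_cast hgt) _
  · cases i with
    | zero =>
      exact (extColimitVanishes_zero_iff _ _).2 (primaryComponent_quotient_primaryComponent _ M)
    | succ i =>
      rw [extColimitVanishes_succ_quotient_primaryComponent_iff, ← isZero_localCoh_succ_iff]
      exact h _ i.succ_ne_zero hi.ne

end Depth

/-! ### Associated primes and localization of MCM modules. -/

section AssociatedPrimes

open RingTheory.Sequence IsLocalRing Pointwise

variable {R : Type u} [CommRing R]

/-- Let `N ≠ 0` consist of the elements killed by `q`. If `N ≤ xM`, regularity of `x` gives `N =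
xN`, against Nakayama. So some `n ∈ N` is nonzero in `M ⧸ xM`, and an associated prime containing
its annihilator contains `q` and `x`. -/
theorem exists_isAssociatedPrime_quotSMulTop [IsNoetherianRing R] [IsLocalRing R] {M : Type v}
    [AddCommGroup M] [Module R M] [Module.Finite R M] {x : R} (hx : x ∈ maximalIdeal R)
    (hreg : IsSMulRegular M x) {q : Ideal R} (hq : IsAssociatedPrime q M) :
    ∃ q' : Ideal R, IsAssociatedPrime q' (QuotSMulTop x M) ∧ q ≤ q' ∧ x ∈ q' := by
  obtain ⟨hqp, y, hy⟩ := isAssociatedPrime_iff.1 hq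
  have hy0 : y ≠ 0 := by
    rintro rfl
    exact hqp.ne_top (by simp [hy])
  let N := Submodule.torsionBySet R M q
  have hyN : y ∈ N := (Submodule.mem_torsionBySet_iff _ _).2 fun a => by
    have := hy.le a.2
    rwa [Submodule.mem_colon_singleton] at this
  obtain ⟨n, hnN, hn⟩ : ∃ n ∈ N, n ∉ x • (⊤ : Submodule R M) := by
    by_contra! hN
    refine hy0 ((Submodule.mem_bot R).1 ?_)
    rw [← Submodule.eq_bot_of_le_smul_of_le_jacobson_bot (Ideal.span {x}) N
      (IsNoetherian.noetherian _) ?_ ?_]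
    · exact hyN
    · intro n hn
      obtain ⟨n', -, rfl⟩ := (Submodule.mem_smul_pointwise_iff_exists _ _ _).1 (hN n hn)
      refine Submodule.smul_mem_smul (Ideal.mem_span_singleton_self x)
        ((Submodule.mem_torsionBySet_iff _ _).2 fun a => hreg.right_eq_zero_of_smul ?_)
      rw [smul_comm]
      exact (Submodule.mem_torsionBySet_iff _ _).1 hn a
    · rw [Ideal.span_singleton_le_iff_mem]
      exact maximalIdeal_le_jacobson _ hx
  obtain ⟨q', hq', hle⟩ := exists_le_isAssociatedPrime_of_isNoetherianRing R
    (Submodule.Quotient.mk n : QuotSMulTop x M) fun h => hn ((Submodule.Quotient.mk_eq_zero _).1 h)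
  refine ⟨q', hq', fun a ha => hle ?_, hle ?_⟩
  · rw [Submodule.mem_colon_singleton, ← Submodule.Quotient.mk_smul,
      (Submodule.mem_torsionBySet_iff _ _).1 hnN ⟨a, ha⟩]
    exact Submodule.zero_mem _
  · rw [Submodule.mem_colon_singleton, ← Submodule.Quotient.mk_smul, Submodule.mem_bot,
      Submodule.Quotient.mk_eq_zero]
    exact Submodule.smul_mem_pointwise_smul _ _ _ trivial

/-- The depth of `M` is at most the dimension of `R ⧸ q` for every associated prime `q` of `M`. -/
theorem le_coheight_of_isAssociatedPrime [IsNoetherianRing R] [IsLocalRing R] {k : ℕ} {M : Type v}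
    [AddCommGroup M] [Module R M] [Module.Finite R M] (h : (k : ℕ∞) ≤ depth R M)
    {q : PrimeSpectrum R} (hq : IsAssociatedPrime q.asIdeal M) : (k : ℕ∞) ≤ Order.coheight q := by
  obtain ⟨rs, rfl, hrs, hreg⟩ := (natCast_le_depth_iff k M).1 h
  clear h
  induction rs generalizing M q with
  | nil => exact zero_le
  | cons x rs ih =>
    rw [isWeaklyRegular_cons_iff] at hreg
    simp only [List.mem_cons, forall_eq_or_imp] at hrs
    obtain ⟨q', hq', hle, hxq'⟩ := exists_isAssociatedPrime_quotSMulTop hrs.1 hreg.1 hq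
    -- Strict because `x ∈ q'`, while a regular element lies in no associated prime of `M`.
    have hlt : q < (⟨q', hq'.isPrime⟩ : PrimeSpectrum R) := by
      refine lt_of_le_of_ne hle fun heq => ?_
      have hxq : x ∈ q.asIdeal := heq ▸ hxq'
      have hzd := biUnion_associatedPrimes_eq_zero_divisors R M
      have : x ∈ ⋃ p ∈ associatedPrimes R M, (p : Set R) := Set.mem_biUnion hq hxq
      rw [hzd] at this
      obtain ⟨y, hy, hxy⟩ := this
      exact hy (hreg.1.right_eq_zero_of_smul hxy)
    refine le_trans ?_ (Order.coheight_add_one_le hlt)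
    rw [List.length_cons, Nat.cast_add, Nat.cast_one]
    gcongr
    exact ih hq' hrs.2 hreg.2

/-- The inequality `depth M ≤ grade(p, M) + dim R ⧸ p`. Divide by regular elements of `p` while
there are any; otherwise prime avoidance puts `p` inside an associated prime `q`, and the depth is
at most `dim R ⧸ q ≤ dim R ⧸ p`. -/
theorem exists_isWeaklyRegular_of_le_depth [IsNoetherianRing R] [IsLocalRing R] {k : ℕ}
    {M : Type u} [AddCommGroup M] [Module R M] [Module.Finite R M] (h : (k : ℕ∞) ≤ depth R M)
    (p : PrimeSpectrum R) :
    ∃ rs : List R, (∀ r ∈ rs, r ∈ p.asIdeal) ∧ IsWeaklyRegular M rs ∧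
      (k : ℕ∞) ≤ rs.length + Order.coheight p := by
  induction k generalizing M with
  | zero => exact ⟨[], by simp, IsWeaklyRegular.nil R M, zero_le⟩
  | succ k ih =>
    by_cases hx : ∃ x ∈ p.asIdeal, IsSMulRegular M x
    · obtain ⟨x, hxp, hx⟩ := hx
      obtain ⟨rs, hrs, hreg, hk⟩ := ih (natCast_le_depth_quotSMulTop h hx)
      refine ⟨x :: rs, by simpa using ⟨hxp, hrs⟩, hreg.cons hx, ?_⟩
      rw [List.length_cons, Nat.cast_add, Nat.cast_add, Nat.cast_one, add_right_comm]
      gcongr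
    · push Not at hx
      obtain ⟨q, hq, hpq⟩ := (Ideal.subset_union_prime_finite (associatedPrimes.finite R M)
        (f := id) 0 0 fun q hq _ _ => hq.1).1 (show (p.asIdeal : Set R) ⊆ _ by
          intro r hr
          simp only [id]
          rw [biUnion_associatedPrimes_eq_zero_divisors R M]
          by_contra! hr0
          refine hx r hr (isSMulRegular_iff_right_eq_zero_of_smul.2 fun y hy => ?_)
          by_contra hy0
          exact hr0 ⟨y, hy0, hy⟩)
      refine ⟨[], by simp, IsWeaklyRegular.nil R M, ?_⟩
      rw [List.length_nil, Nat.cast_zero, zero_add]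
      exact (le_coheight_of_isAssociatedPrime h (q := ⟨q, hq.1⟩) hq).trans
        (Order.coheight_anti hpq)

theorem height_add_coheight_le_ringKrullDim (p : PrimeSpectrum R) :
    ((Order.height p + Order.coheight p : ℕ∞) : WithBot ℕ∞) ≤ ringKrullDim R := by
  have : Nonempty (PrimeSpectrum R) := ⟨p⟩
  rw [ringKrullDim, Order.krullDim_eq_iSup_height_add_coheight_of_nonempty]
  exact WithBot.coe_le_coe.2
    (le_iSup (fun q : PrimeSpectrum R => Order.height q + Order.coheight q) p)

/-- Maximal Cohen--Macaulay modules localize. -/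
theorem IsMCM.localizedModule [IsNoetherianRing R] [IsLocalRing R] {M : Type u} [AddCommGroup M]
    [Module R M] (h : IsMCM R M) (p : Ideal R) [hp : p.IsPrime] :
    IsMCM (Localization.AtPrime p) (LocalizedModule.AtPrime p M) := by
  have := h.1
  have hfin : Module.Finite (Localization.AtPrime p) (LocalizedModule.AtPrime p M) :=
    inferInstance
  obtain ⟨d, hd⟩ : ∃ d : ℕ, ringKrullDim R = d :=
    ⟨_, (IsLocalRing.maximalIdeal_height_eq_ringKrullDim (R := R)).symm.trans
      (congrArg _ (ENat.natCast_toNat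
        (Ideal.height_ne_top (Ideal.IsPrime.ne_top inferInstance))).symm)⟩
  obtain ⟨rs, hrs, hreg, hk⟩ := exists_isWeaklyRegular_of_le_depth
    ((isMCM_iff_of_ringKrullDim_eq hd M).1 h).2 ⟨p, hp⟩
  -- Cancel the finite coheight in `height p + coheight p ≤ d ≤ rs.length + coheight p`.
  have hle : Order.height (⟨p, hp⟩ : PrimeSpectrum R) ≤ rs.length := by
    have h1 := height_add_coheight_le_ringKrullDim (⟨p, hp⟩ : PrimeSpectrum R)
    rw [hd] at h1
    have h2 : Order.height (⟨p, hp⟩ : PrimeSpectrum R) + Order.coheight (⟨p, hp⟩ : PrimeSpectrum R)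
      ≤ d := WithBot.coe_le_coe.1 h1
    have hne : Order.coheight (⟨p, hp⟩ : PrimeSpectrum R) ≠ ⊤ := fun htop => by
      simp [htop] at h2
    exact (ENat.add_le_add_iff_right hne).1 (h2.trans hk)
  refine ⟨hfin, ?_⟩
  rw [IsLocalization.AtPrime.ringKrullDim_eq_height p]
  refine WithBot.coe_le_coe.2 ?_
  refine (PrimeSpectrum.height_eq_orderHeight ⟨p, hp⟩).trans_le
    (hle.trans ((natCast_le_depth_iff _ _).2 ⟨rs.map (algebraMap R _), by simp, ?_,
    hreg.of_isLocalizedModule (Localization.AtPrime p) p.primeCompl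
      (LocalizedModule.mkLinearMap p.primeCompl M)⟩))
  intro r hr
  obtain ⟨r, hr', rfl⟩ := List.mem_map.1 hr
  exact (IsLocalization.AtPrime.to_map_mem_maximal_iff _ p r).2 (hrs r hr')

end AssociatedPrimes

/-! ### Modules that agree on the punctured spectrum. -/

section PuncturedSpectrum

open IsLocalRing

variable {R : Type u} [CommRing R]

theorem bijective_localizedModule_map (S : Submonoid R) {M N : Type*} [AddCommGroup M]
    [Module R M] [AddCommGroup N] [Module R N] (f : M →ₗ[R] N)
    (hker : ∀ x, f x = 0 → ∃ s ∈ S, s • x = 0) (hcoker : ∀ y, ∃ s ∈ S, ∃ x, f x = s • y) :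
    Function.Bijective (LocalizedModule.map S f) := by
  constructor
  · refine (injective_iff_map_eq_zero _).2 fun z hz => ?_
    induction z using LocalizedModule.induction_on with
    | h x t =>
      rw [LocalizedModule.map_mk, ← LocalizedModule.zero_mk 1, LocalizedModule.mk_eq] at hz
      obtain ⟨u, hu⟩ := hz
      rw [smul_zero, smul_zero, one_smul, Submonoid.smul_def, ← map_smul] at hu
      obtain ⟨s, hs, hsu⟩ := hker _ hu
      rw [← LocalizedModule.zero_mk 1, LocalizedModule.mk_eq]
      refine ⟨⟨s, hs⟩ * u, ?_⟩
      rw [smul_zero, smul_zero, one_smul, mul_smul]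
      exact hsu
  · intro z
    induction z using LocalizedModule.induction_on with
    | h y t =>
      obtain ⟨s, hs, x, hx⟩ := hcoker y
      refine ⟨LocalizedModule.mk x (⟨s, hs⟩ * t), ?_⟩
      rw [LocalizedModule.map_mk, hx]
      exact LocalizedModule.mk_cancel_common_left ⟨s, hs⟩ t y

theorem exists_mem_maximalIdeal_notMem [IsLocalRing R] {p : Ideal R} [hp : p.IsPrime]
    (h : p ≠ maximalIdeal R) : ∃ s ∈ maximalIdeal R, s ∉ p :=
  SetLike.not_le_iff_exists.1 fun hle => h ((le_maximalIdeal hp.ne_top).antisymm hle)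

theorem IsMCM.isLocallyMCMOnPuncturedSpectrum [IsNoetherianRing R] [IsLocalRing R] {M : Type u}
    [AddCommGroup M] [Module R M] (h : IsMCM R M) : IsLocallyMCMOnPuncturedSpectrum R M :=
  fun p _ _ => h.localizedModule p

theorem isLocallyMCMOnPuncturedSpectrum_of_quotient_primaryComponent [IsLocalRing R] {M : Type v}
    [AddCommGroup M] [Module R M] (h : IsLocallyMCMOnPuncturedSpectrum R
      (M ⧸ (maximalIdeal R).primaryComponent M)) : IsLocallyMCMOnPuncturedSpectrum R M := by
  intro p hp hpm
  obtain ⟨s, hs, hsp⟩ := exists_mem_maximalIdeal_notMem hpm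
  refine (h p hpm).of_linearEquiv (LinearEquiv.ofBijective
    (LocalizedModule.map p.primeCompl ((maximalIdeal R).primaryComponent M).mkQ)
    (bijective_localizedModule_map _ _ (fun x hx => ?_) fun y => ?_)).symm
  · obtain ⟨n, hn⟩ := (mem_primaryComponent_iff _ _).1 ((Submodule.Quotient.mk_eq_zero _).1 hx)
    exact ⟨s ^ n, pow_mem (S := p.primeCompl) hsp n, hn _ (Ideal.pow_mem_pow hs n)⟩
  · obtain ⟨x, hx⟩ := Submodule.mkQ_surjective _ y
    exact ⟨1, one_mem _, x, by rw [hx, one_smul]⟩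

/-- An element of `𝔪` outside `p` becomes a unit in `R_p`, so `𝔪` and `R` have the same localization
there. -/
theorem isLocallyMCMOnPuncturedSpectrum_maximalIdeal [IsLocalRing R]
    (h : IsLocallyMCMOnPuncturedSpectrum R R) :
    IsLocallyMCMOnPuncturedSpectrum R (maximalIdeal R) := by
  intro p hp hpm
  obtain ⟨s, hs, hsp⟩ := exists_mem_maximalIdeal_notMem hpm
  refine (h p hpm).of_linearEquiv (LinearEquiv.ofBijective
    (LocalizedModule.map p.primeCompl (maximalIdeal R).subtype)
    (bijective_localizedModule_map _ _ (fun x hx => ?_) fun y => ?_)).symm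
  · exact ⟨1, one_mem _, by rw [one_smul]; exact Subtype.ext hx⟩
  · exact ⟨s, hsp, ⟨s * y, Ideal.mul_mem_right _ _ hs⟩, rfl⟩

end PuncturedSpectrum

/-! ### Finite length and `𝔪`-torsion. -/

section FiniteLength

open IsLocalRing

variable {R : Type u} [CommRing R] [IsLocalRing R]

theorem isArtinianRing_quotient_maximalIdeal_pow [IsNoetherianRing R] (n : ℕ) :
    IsArtinianRing (R ⧸ maximalIdeal R ^ n) := by
  rcases subsingleton_or_nontrivial (R ⧸ maximalIdeal R ^ n) with _ | _
  · infer_instance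
  have := IsLocalRing.of_surjective' (Ideal.Quotient.mk (maximalIdeal R ^ n))
    Ideal.Quotient.mk_surjective
  rw [isArtinianRing_iff_isNilpotent_maximalIdeal]
  refine ⟨n, ?_⟩
  rw [← map_maximalIdeal_of_surjective (Ideal.Quotient.mk (maximalIdeal R ^ n))
    Ideal.Quotient.mk_surjective, ← Ideal.map_pow, Ideal.map_quotient_self]
  rfl

/-- Some `𝔪 ^ n` kills `L`, which is thus a finite module over the Artinian ring `R ⧸ 𝔪 ^ n`. -/
theorem isFiniteLength_of_primaryComponent_eq_top [IsNoetherianRing R] (L : Type v)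
    [AddCommGroup L] [Module R L] [Module.Finite R L]
    (hL : (maximalIdeal R).primaryComponent L = ⊤) : IsFiniteLength R L := by
  obtain ⟨n, hn⟩ := exists_pow_smul_eq_zero_of_le_primaryComponent (maximalIdeal R)
    (Module.Finite.fg_top (R := R) (M := L)) hL.ge
  let : Module (R ⧸ maximalIdeal R ^ n) L := Module.IsTorsionBySet.module
    (I := maximalIdeal R ^ n) fun x a => hn a.1 a.2 x trivial
  have : IsScalarTower R (R ⧸ maximalIdeal R ^ n) L := ⟨fun b d x =>
    Quotient.inductionOn' d fun c => (smul_assoc b c x :)⟩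
  have := isArtinianRing_quotient_maximalIdeal_pow (R := R) n
  have : Module.Finite (R ⧸ maximalIdeal R ^ n) L := Module.Finite.of_restrictScalars_finite R _ _
  have : IsArtinian R L := isArtinian_of_surjective_algebraMap
    (R := R ⧸ maximalIdeal R ^ n) Ideal.Quotient.mk_surjective
  exact isFiniteLength_iff_isNoetherian_isArtinian.2 ⟨inferInstance, inferInstance⟩

theorem primaryComponent_eq_top_of_isFiniteLength [IsNoetherianRing R] {L : Type v}
    [AddCommGroup L] [Module R L] (hL : IsFiniteLength R L) :
    (maximalIdeal R).primaryComponent L = ⊤ := by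
  induction hL with
  | of_subsingleton => exact Subsingleton.elim _ _
  | @of_simple_quotient M _ _ N _ _ ih =>
    have hN : N ≤ (maximalIdeal R).primaryComponent M := fun x hx =>
      Ideal.primaryComponent_map_mem _ N.subtype ⟨⟨x, hx⟩, ih ▸ trivial⟩
    have hann : Module.annihilator R (M ⧸ N) = maximalIdeal R :=
      eq_maximalIdeal IsSimpleModule.annihilator_isMaximal
    -- `𝔪` kills the simple quotient, so `𝔪 • x` lies in `N ≤ Γ(M)`; and `M ⧸ Γ(M)` has no torsion.
    refine eq_top_iff.2 fun x _ => (Submodule.Quotient.mk_eq_zero _).1 <| (Submodule.mem_bot R).1 <|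
      primaryComponent_quotient_primaryComponent (maximalIdeal R) M ▸
      (mem_primaryComponent_iff _ _).2 ⟨1, fun a ha => ?_⟩
    rw [pow_one, ← hann, Module.mem_annihilator] at ha
    rw [← Submodule.Quotient.mk_smul, Submodule.Quotient.mk_eq_zero]
    exact hN ((Submodule.Quotient.mk_eq_zero _).1 (ha (Submodule.Quotient.mk x)))

theorem isExtMCMByFiniteLength_iff [IsNoetherianRing R] {d : ℕ} (hd : 0 < d)
    (hdim : ringKrullDim R = d) (M : Type v) [AddCommGroup M] [Module R M] [Module.Finite R M] :
    IsExtMCMByFiniteLength R M ↔ IsMCM R (M ⧸ (maximalIdeal R).primaryComponent M) := by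
  constructor
  · rintro ⟨L, N, _, _, _, _, f, g, hf, hfg, hg, hL, hN⟩
    have hN0 : (maximalIdeal R).primaryComponent N = ⊥ :=
      primaryComponent_eq_bot_of_one_le_depth
        (le_trans (by exact_mod_cast hd) ((isMCM_iff_of_ringKrullDim_eq hdim N).1 hN).2)
    have hL0 := primaryComponent_eq_top_of_isFiniteLength hL
    have hker : LinearMap.ker g = (maximalIdeal R).primaryComponent M := by
      refine le_antisymm (fun x hx => ?_) fun x hx => ?_
      · obtain ⟨y, rfl⟩ := (hfg x).1 hx
        exact Ideal.primaryComponent_map_mem _ f ⟨y, hL0 ▸ trivial⟩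
      · exact (Submodule.mem_bot R).1
          (hN0 ▸ Ideal.primaryComponent_map_mem (maximalIdeal R) g ⟨x, hx⟩)
    exact hN.of_linearEquiv ((Submodule.quotEquivOfEq _ _ hker.symm).trans
      (g.quotKerEquivOfSurjective hg)).symm
  · intro h
    exact ⟨(maximalIdeal R).primaryComponent M, _, inferInstance, inferInstance, inferInstance,
      inferInstance, _, _, Submodule.subtype_injective _, LinearMap.exact_subtype_mkQ _,
      Submodule.mkQ_surjective _, isFiniteLength_of_primaryComponent_eq_top _
        (primaryComponent_primaryComponent _ M), h⟩

end FiniteLength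

/-! ### The maximal ideal as a counterexample. -/

section MaximalIdeal

open RingTheory.Sequence IsLocalRing Pointwise

variable {R : Type u} [CommRing R] [IsLocalRing R]

theorem IsCMLocalRing.isMCM (hR : IsCMLocalRing R) : IsMCM R R :=
  ⟨inferInstance, hR.2.ge⟩

/-- In `𝔪 ⧸ x𝔪` one has `y • [x] = x • [y] = 0`. If `y` were regular there, then `x ∈ x𝔪`, so `x =
0`, which is regular on `𝔪` only when `𝔪 = 0`. -/
theorem not_two_le_depth_maximalIdeal (h : maximalIdeal R ≠ ⊥) :
    ¬ (2 : ℕ∞) ≤ depth R (maximalIdeal R) := by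
  intro h2
  obtain ⟨rs, hlen, hrs, hreg⟩ := (natCast_le_depth_iff 2 (maximalIdeal R)).1 h2
  obtain ⟨x, y, rfl⟩ := List.length_eq_two.1 hlen
  have hx : x ∈ maximalIdeal R := hrs x (by simp)
  have hy : y ∈ maximalIdeal R := hrs y (by simp)
  rw [isWeaklyRegular_cons_iff, isWeaklyRegular_singleton_iff] at hreg
  obtain ⟨hregx, hregy⟩ := hreg
  have hzero : (Submodule.Quotient.mk ⟨x, hx⟩ : QuotSMulTop x (maximalIdeal R)) = 0 := by
    refine hregy.right_eq_zero_of_smul ?_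
    rw [← Submodule.Quotient.mk_smul, Submodule.Quotient.mk_eq_zero,
      show y • (⟨x, hx⟩ : maximalIdeal R) = x • ⟨y, hy⟩ from Subtype.ext (mul_comm y x)]
    exact Submodule.smul_mem_pointwise_smul _ _ _ trivial
  obtain ⟨a, -, ha⟩ := (Submodule.mem_smul_pointwise_iff_exists _ _ _).1
    ((Submodule.Quotient.mk_eq_zero _).1 hzero)
  have hxa : x * a.1 = x := congrArg Subtype.val ha
  have hunit : IsUnit (1 - a.1) := by
    by_contra hna
    exact (mem_maximalIdeal _).1 ((Submodule.sub_mem_iff_left _ a.2).1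
      ((mem_maximalIdeal _).2 hna)) isUnit_one
  have hx0 : x = 0 := hunit.mul_left_eq_zero.1 (by rw [mul_sub, mul_one, hxa, sub_self])
  refine h (eq_bot_iff.2 fun z hz => ?_)
  have : (⟨z, hz⟩ : maximalIdeal R) = 0 :=
    hregx.right_eq_zero_of_smul (by rw [hx0, zero_smul])
  exact congrArg Subtype.val this

theorem not_isHSpherical_maximalIdeal (hR : IsCMLocalRing R) {d : ℕ} (hd : 2 ≤ d)
    (hdim : ringKrullDim R = d) : ¬ IsHSpherical R d (maximalIdeal R) := by
  have := hR.1
  intro h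
  have hdepth : (1 : ℕ∞) ≤ depth R R := le_trans
    (by exact_mod_cast one_le_two.trans hd) ((isMCM_iff_of_ringKrullDim_eq hdim R).1 hR.isMCM).2
  have hR0 := primaryComponent_eq_bot_of_one_le_depth hdepth
  have hm0 : (maximalIdeal R).primaryComponent (maximalIdeal R) = ⊥ := eq_bot_iff.2 fun x hx =>
    Subtype.ext ((Submodule.mem_bot R).1
      (hR0 ▸ Ideal.primaryComponent_map_mem _ (maximalIdeal R).subtype ⟨x, hx⟩))
  have hmcm : IsMCM R (maximalIdeal R) :=
    ((isMCM_quotient_primaryComponent_iff_isHSpherical hdim _).2 h).of_linearEquiv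
      (Submodule.quotEquivOfEqBot _ hm0)
  refine not_two_le_depth_maximalIdeal (fun hbot => ?_) (le_trans (by exact_mod_cast hd)
    ((isMCM_iff_of_ringKrullDim_eq hdim _).1 hmcm).2)
  -- If `𝔪` were zero, 1 would be `𝔪`-torsion, against `Γ(R) = 0`.
  refine one_ne_zero (α := R) ((Submodule.mem_bot R).1 (hR0 ▸ (mem_primaryComponent_iff _ _).2
    ⟨1, fun a ha => ?_⟩))
  rw [pow_one, hbot, Ideal.mem_bot] at ha
  rw [ha, zero_smul]

end MaximalIdeal

end CMSpherical

theorem proposition2p9 (R : Type u) [CommRing R] [IsLocalRing R] (hR : CMSpherical.IsCMLocalRing R)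
    (d : ℕ) (hd : 0 < d) (hdim : ringKrullDim R = d) :
    (∀ (M : Type u) [AddCommGroup M] [Module R M] [Module.Finite R M],
      (CMSpherical.IsExtMCMByFiniteLength R M ↔
        CMSpherical.IsMCM R (M ⧸ (IsLocalRing.maximalIdeal R).primaryComponent M)) ∧
      (CMSpherical.IsMCM R (M ⧸ (IsLocalRing.maximalIdeal R).primaryComponent M) ↔
        CMSpherical.IsHSpherical R d M) ∧
      (CMSpherical.IsHSpherical R d M → CMSpherical.IsLocallyMCMOnPuncturedSpectrum R M) ∧
      (d = 1 → CMSpherical.IsLocallyMCMOnPuncturedSpectrum R M →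
        CMSpherical.IsHSpherical R d M)) ∧
    (2 ≤ d →
      Module.Finite R (IsLocalRing.maximalIdeal R) ∧
      CMSpherical.IsLocallyMCMOnPuncturedSpectrum R (IsLocalRing.maximalIdeal R) ∧
      ¬ CMSpherical.IsHSpherical R d (IsLocalRing.maximalIdeal R)) := by
  have := hR.1
  refine ⟨fun M _ _ _ => ⟨CMSpherical.isExtMCMByFiniteLength_iff hd hdim M,
    CMSpherical.isMCM_quotient_primaryComponent_iff_isHSpherical hdim M, fun h => ?_,
    fun hd1 _ => ⟨inferInstance, fun i hi0 hid => ?_⟩⟩, fun hd2 => ⟨inferInstance,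
    CMSpherical.isLocallyMCMOnPuncturedSpectrum_maximalIdeal
      hR.isMCM.isLocallyMCMOnPuncturedSpectrum,
    CMSpherical.not_isHSpherical_maximalIdeal hR hd2 hdim⟩⟩
  · exact CMSpherical.isLocallyMCMOnPuncturedSpectrum_of_quotient_primaryComponent
      ((CMSpherical.isMCM_quotient_primaryComponent_iff_isHSpherical hdim M).2
        h).isLocallyMCMOnPuncturedSpectrum
  · refine CMSpherical.isZero_localCoh_of_ringKrullDim_lt i ?_ _
    rw [hdim]
    exact_mod_cast (by omega : d < i)
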